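/- Write $Du=(u_1,u_2)$ for the gradient, $u_i=\partial u/\partial x_i$, $u_{ij}=\partial^2u/\partial x_i\partial x_j$, $|\cdot|$ for the Euclidean norm and $B_R(0)$ for the open disc of radius $R$ about the origin of $\mathbb R^2$. **Theorem.** For every $\gamma\ge 1$ there is an exponent $\alpha\in(0,1]$, depending only on $\gamma$, such that the following holds. Let $\Omega\subset\mathbb R^2$ be a bounded domain with $\Omega\subset B_R(0)$, let $a_{11},a_{12},a_{22}$ be real functions on $\mathbb R^2\setminus\overline\Omega$, and suppose there are constants $0<\lambda\le\Lambda$ with $\Lambda/\lambda\le\gamma$ and $$\lambda(\xi_1^2+\xi_2^2)\le a_{11}(x)\xi_1^2+2a_{12}(x)\xi_1\xi_2+a_{22}(x)\xi_2^2\le\Lambda(\xi_1^2+\xi_2^2)$$ for all $x\in\mathbb R^2\setminus\overline\Omega$ and all $(\xi_1,\xi_2)\in\mathbb R^2$. Let $u\in C^2(\mathbb R^2\setminus\overline\Omega)$ satisfy $$a_{11}u_{11}+2a_{12}u_{12}+a_{22}u_{22}=0\quad\text{and}\quad |Du|\le M\qquad\text{in }\mathbb R^2\setminus\overline\Omega .$$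 Let $\Omega'\ne\mathbb R^2$ be an open set with $\overline\Omega\subset\Omega'$, and let $d=\operatorname{dist}(\Omega,\partial\Omega')$. Then: 1. $|Du(x)-Du(y)|\le C|x-y|^{\alpha}$ for all $x,y\in\mathbb R^2\setminus\overline{\Omega'}$, where $C$ depends only on $\gamma$, $d$ and $M$. 2. $Du(x)$ tends to a limit $Du(\infty)\in\mathbb R^2$ as $|x|\to\infty$, and $|Du(x)-Du(\infty)|\le C'|x|^{-\alpha}$ for all $x\in\mathbb R^2\setminus\overline{\Omega'}$ with $x\neq0$, where $C'$ depends only on $\gamma$, $d$, $M$ and $R$. 3. The map $(p,q)=(u_2,u_1)$ is $K$-quasiconformal in $\mathbb R^2\setminus\overline\Omega$ with $K=\frac{1+\gamma}2$; that is, $p,q\in C^1(\mathbb R^2\setminus\overline\Omega)$ and $p_1^2+p_2^2+q_1^2+q_2^2\le 2K(p_1q_2-p_2q_1)$ there. -/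

import Mathlib

open Set Filter Topology

/-- The Euclidean plane. -/
abbrev Plane : Type := EuclideanSpace ℝ (Fin 2)

/-- The partial derivative of `f` at `x` in the direction of the `i`-th coordinate
(the coordinates `x₁, x₂` are numbered `0, 1`). -/
noncomputable def partialDeriv (i : Fin 2) (f : Plane → ℝ) (x : Plane) : ℝ :=
  fderiv ℝ f x (EuclideanSpace.single i 1)

/-- `L = a₁₁ ∂₁₁ + 2 a₁₂ ∂₁₂ + a₂₂ ∂₂₂` is uniformly elliptic on `U`, with ellipticity
constants `0 < lam ≤ Lam` whose ratio is at most `γ`. -/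
def IsUniformlyElliptic (γ : ℝ) (U : Set Plane) (a₁₁ a₁₂ a₂₂ : Plane → ℝ) : Prop :=
  ∃ lam Lam : ℝ, 0 < lam ∧ lam ≤ Lam ∧ Lam / lam ≤ γ ∧
    ∀ x ∈ U, ∀ ξ₁ ξ₂ : ℝ,
      lam * (ξ₁ ^ 2 + ξ₂ ^ 2) ≤ a₁₁ x * ξ₁ ^ 2 + 2 * a₁₂ x * ξ₁ * ξ₂ + a₂₂ x * ξ₂ ^ 2 ∧
      a₁₁ x * ξ₁ ^ 2 + 2 * a₁₂ x * ξ₁ * ξ₂ + a₂₂ x * ξ₂ ^ 2 ≤ Lam * (ξ₁ ^ 2 + ξ₂ ^ 2)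

/-- `u` is a `C²` solution of `a₁₁ u₁₁ + 2 a₁₂ u₁₂ + a₂₂ u₂₂ = 0` on `U` (used for open `U`). -/
def IsClassicalSolution (U : Set Plane) (a₁₁ a₁₂ a₂₂ u : Plane → ℝ) : Prop :=
  ContDiffOn ℝ 2 u U ∧
    ∀ x ∈ U,
      a₁₁ x * partialDeriv 0 (partialDeriv 0 u) x
        + 2 * a₁₂ x * partialDeriv 1 (partialDeriv 0 u) x
        + a₂₂ x * partialDeriv 1 (partialDeriv 1 u) x = 0

/-- The map `w = (p, q)` is `K`-quasiconformal on `U` (used for open `U`): it is `C¹` and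
`p₁² + p₂² + q₁² + q₂² ≤ 2 K (p₁ q₂ - p₂ q₁)`. -/
def IsQuasiconformalOn (K : ℝ) (U : Set Plane) (p q : Plane → ℝ) : Prop :=
  ContDiffOn ℝ 1 p U ∧ ContDiffOn ℝ 1 q U ∧
    ∀ x ∈ U,
      partialDeriv 0 p x ^ 2 + partialDeriv 1 p x ^ 2
          + partialDeriv 0 q x ^ 2 + partialDeriv 1 q x ^ 2
        ≤ 2 * K * (partialDeriv 0 p x * partialDeriv 1 q x
            - partialDeriv 1 p x * partialDeriv 0 q x)

/-!
The gradient of a solution is, up to the order of its components, a bounded quasiconformal map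
`(p, q) = (u₂, u₁)` (`sq_add_sq_le_of_elliptic`), and quasiconformality survives conformal changes
of coordinates. In log-polar coordinates both a punctured disc about a point and the exterior of a
disc become a half-cylinder `{s > 0} × ℝ/2πℤ`, so that the interior Hölder estimate and the decay
at infinity are the same statement: a bounded quasiconformal map `(P, Q)` of the half-cylinder has
oscillation `O(exp (-α s))` beyond height `s`, with `α` depending on `K` only
(`IsQuasiconformalCylinder.abs_fst_sub_le_exp`).

Everything about the half-cylinder follows from the circulation `A(s) = ∫ P dQ` around the circle at
height `s`. Stokes' theorem gives `A'(s) = ∫ J dθ`, where `J` is the Jacobian; it holds for `C¹`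
maps (`IsC1OnHalfCylinder.hasDerivAt_circulation`). Since `J` controls `|DP|² + |DQ|²`, the
Cauchy–Schwarz inequality yields both `A² ≤ C M² A'`, where `M` bounds the map, and the
isoperimetric inequality `|A| ≤ C A'`, with constants depending on `K`. The first is a Riccati
inequality on a half-line: it forces `A ≤ 0` and bounds `-A(2)`. The second then makes `-A` decay
exponentially. By the mean value theorem for `A`, every strip of height `1` contains a circle of
exponentially small energy, on which the oscillation is exponentially small.

The oscillation beyond a circle is at most that on the circle by a maximum principle which includes
the end of the cylinder (`IsQuasiconformalCylinder.fst_le_of_circle_le`). It comes from the same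
circulation identity for `∫ ((P - k)⁺)² dQ`, as the circles of small energy rule out a contribution
from infinity.

In the disc, the limit at the end of the cylinder is the value at the centre; in the exterior, the
estimate is a Cauchy condition at infinity. Pairs of points too far apart for the first estimate and
points too near the origin for the second are covered by the bound on the gradient.
-/

/-! ### Periodic `C¹` functions on a half-cylinder -/

/-- `f` is `C¹` on the half-cylinder `{s > 0} × ℝ/2πℤ`, with partial derivatives `fs` and `ft` in
the axial variable `s` and in the angle `θ`. A function on the half-cylinder is encoded as a
function of `(s, θ)` that has period `2π` in `θ`; its values at `s ≤ 0` play no role. -/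
structure IsC1OnHalfCylinder (f fs ft : ℝ → ℝ → ℝ) : Prop where
  hasDerivAt_left : ∀ s, 0 < s → ∀ θ, HasDerivAt (fun σ => f σ θ) (fs s θ) s
  hasDerivAt_right : ∀ s, 0 < s → ∀ θ, HasDerivAt (f s) (ft s θ) θ
  continuousOn : ContinuousOn (fun z : ℝ × ℝ => f z.1 z.2) (Ioi 0 ×ˢ univ)
  continuousOn_left : ContinuousOn (fun z : ℝ × ℝ => fs z.1 z.2) (Ioi 0 ×ˢ univ)
  continuousOn_right : ContinuousOn (fun z : ℝ × ℝ => ft z.1 z.2) (Ioi 0 ×ˢ univ)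
  periodic : ∀ s, 0 < s → Function.Periodic (f s) (2 * Real.pi)

theorem continuous_slice {f : ℝ → ℝ → ℝ}
    (hf : ContinuousOn (fun z : ℝ × ℝ => f z.1 z.2) (Ioi 0 ×ˢ univ)) {s : ℝ} (hs : 0 < s) :
    Continuous (f s) := by
  have h : ContinuousOn (fun θ : ℝ => f s θ) univ :=
    hf.comp (f := fun θ : ℝ => (s, θ)) (by fun_prop) (fun θ _ => ⟨hs, mem_univ _⟩)
  exact continuousOn_univ.1 h

/-- A continuous function on the half-cylinder is bounded near each circle. -/
theorem exists_bound_near_circle {f : ℝ → ℝ → ℝ}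
    (hf : ContinuousOn (fun z : ℝ × ℝ => f z.1 z.2) (Ioi 0 ×ˢ univ)) {s : ℝ} (hs : 0 < s) :
    ∃ B, ∀ σ ∈ Icc (s / 2) (2 * s), ∀ θ ∈ Icc 0 (2 * Real.pi), ‖f σ θ‖ ≤ B := by
  have hK : IsCompact (Icc (s / 2) (2 * s) ×ˢ Icc 0 (2 * Real.pi)) :=
    isCompact_Icc.prod isCompact_Icc
  obtain ⟨B, hB⟩ := hK.exists_bound_of_continuousOn
    (hf.mono (prod_mono (fun x hx => lt_of_lt_of_le (by positivity) hx.1) (subset_univ _)))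
  exact ⟨B, fun σ hσ θ hθ => hB (σ, θ) ⟨hσ, hθ⟩⟩

namespace IsC1OnHalfCylinder

variable {f fs ft g gs gt : ℝ → ℝ → ℝ}

theorem neg (hf : IsC1OnHalfCylinder f fs ft) :
    IsC1OnHalfCylinder (fun s θ => -f s θ) (fun s θ => -fs s θ) (fun s θ => -ft s θ) where
  hasDerivAt_left s hs θ := (hf.hasDerivAt_left s hs θ).neg
  hasDerivAt_right s hs θ := (hf.hasDerivAt_right s hs θ).neg
  continuousOn := hf.continuousOn.neg
  continuousOn_left := hf.continuousOn_left.neg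
  continuousOn_right := hf.continuousOn_right.neg
  periodic s hs θ := congrArg Neg.neg (hf.periodic s hs θ)

theorem integral_right_eq_sub (hf : IsC1OnHalfCylinder f fs ft) {s : ℝ} (hs : 0 < s) (a b : ℝ) :
    ∫ θ in a..b, ft s θ = f s b - f s a :=
  intervalIntegral.integral_eq_sub_of_hasDerivAt (fun θ _ => hf.hasDerivAt_right s hs θ)
    ((continuous_slice hf.continuousOn_right hs).intervalIntegrable _ _)

/-- Integration by parts over a circle; the boundary terms cancel by periodicity. -/
theorem integral_mul_right (hf : IsC1OnHalfCylinder f fs ft) (hg : IsC1OnHalfCylinder g gs gt)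
    {s σ : ℝ} (hs : 0 < s) (hσ : 0 < σ) :
    ∫ θ in 0..2 * Real.pi, f s θ * gt σ θ = -∫ θ in 0..2 * Real.pi, ft s θ * g σ θ := by
  rw [intervalIntegral.integral_mul_deriv_eq_deriv_mul
    (fun θ _ => hf.hasDerivAt_right s hs θ) (fun θ _ => hg.hasDerivAt_right σ hσ θ)
    ((continuous_slice hf.continuousOn_right hs).intervalIntegrable _ _)
    ((continuous_slice hg.continuousOn_right hσ).intervalIntegrable _ _)]
  have h1 := hf.periodic s hs 0
  have h2 := hg.periodic σ hσ 0
  rw [zero_add] at h1 h2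
  rw [h1, h2]
  ring

/-- Axial difference quotients are bounded uniformly in the angle. -/
theorem exists_slope_bound (hf : IsC1OnHalfCylinder f fs ft) {s : ℝ} (hs : 0 < s) :
    ∃ B, ∀ σ ∈ Icc (s / 2) (2 * s), ∀ θ ∈ Icc 0 (2 * Real.pi),
      ‖(σ - s)⁻¹ * (f σ θ - f s θ)‖ ≤ B := by
  obtain ⟨B, hB⟩ := exists_bound_near_circle hf.continuousOn_left hs
  refine ⟨B, fun σ hσ θ hθ => ?_⟩
  have hs' : s ∈ Icc (s / 2) (2 * s) := ⟨by linarith, by linarith⟩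
  have hB0 : 0 ≤ B := (norm_nonneg _).trans (hB s hs' θ hθ)
  have h : ‖f σ θ - f s θ‖ ≤ B * ‖σ - s‖ :=
    Convex.norm_image_sub_le_of_norm_hasDerivWithin_le (f := fun σ => f σ θ)
      (fun x hx => (hf.hasDerivAt_left x (lt_of_lt_of_le (by positivity) hx.1) θ).hasDerivWithinAt)
      (fun x hx => hB x hx θ hθ) (convex_Icc _ _) hs' hσ
  rw [norm_mul, norm_inv]
  rcases eq_or_ne σ s with rfl | hne
  · simpa using hB0
  · rw [inv_mul_le_iff₀ (norm_pos_iff.2 (sub_ne_zero.2 hne)), mul_comm]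
    exact h

/-- The circulation `∫ f dg` around the circle at height `s` has the derivative
`∫ (f_s g_θ - f_θ g_s) dθ`. This is Stokes' theorem for the form `f dg` with `f` and `g` merely
`C¹`: integrating by parts in the angle turns the difference quotient of the circulation into an
expression in the difference quotients of `f` and `g`, so no second derivative appears. -/
theorem hasDerivAt_circulation (hf : IsC1OnHalfCylinder f fs ft) (hg : IsC1OnHalfCylinder g gs gt)
    {s : ℝ} (hs : 0 < s) :
    HasDerivAt (fun σ => ∫ θ in 0..2 * Real.pi, f σ θ * gt σ θ)
      (∫ θ in 0..2 * Real.pi, (fs s θ * gt s θ - ft s θ * gs s θ)) s := by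
  rw [hasDerivAt_iff_tendsto_slope]
  have hnhds : ∀ᶠ σ in 𝓝[≠] s, σ ∈ Icc (s / 2) (2 * s) :=
    nhdsWithin_le_nhds (Icc_mem_nhds (by linarith) (by linarith))
  have hs' : s ∈ Icc (s / 2) (2 * s) := ⟨by linarith, by linarith⟩
  have hpos : ∀ σ ∈ Icc (s / 2) (2 * s), 0 < σ := fun σ hσ =>
    lt_of_lt_of_le (by positivity) hσ.1
  have key : ∀ σ, 0 < σ →
      ∫ θ in 0..2 * Real.pi, ((σ - s)⁻¹ * (f σ θ - f s θ) * gt σ θ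
          - ft s θ * ((σ - s)⁻¹ * (g σ θ - g s θ)))
        = slope (fun σ => ∫ θ in 0..2 * Real.pi, f σ θ * gt σ θ) s σ := by
    intro σ hσ
    have cfσ := continuous_slice hf.continuousOn hσ
    have cfs := continuous_slice hf.continuousOn hs
    have cft := continuous_slice hf.continuousOn_right hs
    have cgσ := continuous_slice hg.continuousOn hσ
    have cgs := continuous_slice hg.continuousOn hs
    have cgtσ := continuous_slice hg.continuousOn_right hσ
    have cgts := continuous_slice hg.continuousOn_right hs
    have e1 := hf.integral_mul_right hg hs hσ
    have e2 := hf.integral_mul_right hg hs hs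
    have e3 : ∀ θ, (σ - s)⁻¹ * (f σ θ - f s θ) * gt σ θ - ft s θ * ((σ - s)⁻¹ * (g σ θ - g s θ))
        = (σ - s)⁻¹ * ((f σ θ * gt σ θ - f s θ * gt σ θ) - (ft s θ * g σ θ - ft s θ * g s θ)) :=
      fun θ => by ring
    simp_rw [e3]
    rw [intervalIntegral.integral_const_mul, intervalIntegral.integral_sub,
      intervalIntegral.integral_sub, intervalIntegral.integral_sub, e1, slope_def_field, e2]
    · ring
    all_goals exact Continuous.intervalIntegrable (by fun_prop) _ _
  refine Tendsto.congr' (hnhds.mono fun σ hσ => key σ (hpos σ hσ)) ?_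
  obtain ⟨B₁, hB₁⟩ := hf.exists_slope_bound hs
  obtain ⟨B₂, hB₂⟩ := hg.exists_slope_bound hs
  obtain ⟨B₃, hB₃⟩ := exists_bound_near_circle hg.continuousOn_right hs
  obtain ⟨B₄, hB₄⟩ := exists_bound_near_circle hf.continuousOn_right hs
  have hΙ : uIoc 0 (2 * Real.pi) ⊆ Icc 0 (2 * Real.pi) := by
    rw [uIoc_of_le Real.two_pi_pos.le]
    exact Ioc_subset_Icc_self
  refine intervalIntegral.tendsto_integral_filter_of_dominated_convergence
    (fun _ => B₁ * B₃ + B₄ * B₂) ?_ ?_ intervalIntegrable_const ?_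
  · filter_upwards [hnhds] with σ hσ
    have cfσ := continuous_slice hf.continuousOn (hpos σ hσ)
    have cfs := continuous_slice hf.continuousOn hs
    have cft := continuous_slice hf.continuousOn_right hs
    have cgσ := continuous_slice hg.continuousOn (hpos σ hσ)
    have cgs := continuous_slice hg.continuousOn hs
    have cgtσ := continuous_slice hg.continuousOn_right (hpos σ hσ)
    exact Continuous.aestronglyMeasurable (by fun_prop)
  · filter_upwards [hnhds] with σ hσ
    refine Eventually.of_forall fun θ hθ => (norm_sub_le _ _).trans ?_
    rw [norm_mul, norm_mul (ft s θ)]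
    exact add_le_add
      (mul_le_mul (hB₁ σ hσ θ (hΙ hθ)) (hB₃ σ hσ θ (hΙ hθ)) (norm_nonneg _)
        ((norm_nonneg _).trans (hB₁ σ hσ θ (hΙ hθ))))
      (mul_le_mul (hB₄ s hs' θ (hΙ hθ)) (hB₂ σ hσ θ (hΙ hθ)) (norm_nonneg _)
        ((norm_nonneg _).trans (hB₄ s hs' θ (hΙ hθ))))
  · refine Eventually.of_forall fun θ _ => ?_
    have t1 := hasDerivAt_iff_tendsto_slope.1 (hf.hasDerivAt_left s hs θ)
    have t2 := hasDerivAt_iff_tendsto_slope.1 (hg.hasDerivAt_left s hs θ)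
    have t3 : Tendsto (fun σ => gt σ θ) (𝓝[≠] s) (𝓝 (gt s θ)) := by
      have hc : ContinuousAt (fun z : ℝ × ℝ => gt z.1 z.2) (s, θ) :=
        hg.continuousOn_right.continuousAt
          ((isOpen_Ioi.prod isOpen_univ).mem_nhds ⟨hs, mem_univ _⟩)
      have hc' : ContinuousAt (fun σ : ℝ => gt σ θ) s :=
        ContinuousAt.comp (f := fun σ : ℝ => (σ, θ)) hc (by fun_prop)
      exact hc'.tendsto.mono_left nhdsWithin_le_nhds
    exact (t1.mul t3).sub (t2.const_mul (ft s θ))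

theorem abs_integral_right_le (hf : IsC1OnHalfCylinder f fs ft) {s : ℝ} (hs : 0 < s) {a b : ℝ}
    (ha : a ∈ Icc 0 (2 * Real.pi)) (hb : b ∈ Icc 0 (2 * Real.pi)) :
    |f s a - f s b| ≤ ∫ θ in 0..2 * Real.pi, |ft s θ| := by
  have hint : ∀ a b, IntervalIntegrable (fun θ => |ft s θ|) MeasureTheory.volume a b := fun a b =>
    (continuous_slice hf.continuousOn_right hs).abs.intervalIntegrable a b
  wlog h : b ≤ a generalizing a b
  · rw [abs_sub_comm]
    exact this hb ha (le_of_not_ge h)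
  rw [← hf.integral_right_eq_sub hs]
  refine (intervalIntegral.abs_integral_le_integral_abs h).trans ?_
  exact intervalIntegral.integral_mono_interval hb.1 h ha.2
    (Eventually.of_forall fun _ => abs_nonneg _) (hint _ _)

/-- The oscillation over a circle is at most the total variation. -/
theorem abs_sub_le_integral_abs (hf : IsC1OnHalfCylinder f fs ft) {s : ℝ} (hs : 0 < s) (a b : ℝ) :
    |f s a - f s b| ≤ ∫ θ in 0..2 * Real.pi, |ft s θ| := by
  obtain ⟨a', ha', ha⟩ := (hf.periodic s hs).exists_mem_Ico₀ Real.two_pi_pos a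
  obtain ⟨b', hb', hb⟩ := (hf.periodic s hs).exists_mem_Ico₀ Real.two_pi_pos b
  rw [ha, hb]
  exact hf.abs_integral_right_le hs (Ico_subset_Icc_self ha') (Ico_subset_Icc_self hb')

end IsC1OnHalfCylinder

/-- The Cauchy–Schwarz inequality against the constant `1` on a circle. -/
theorem sq_integral_abs_le {h : ℝ → ℝ} (hc : Continuous h) :
    (∫ θ in 0..2 * Real.pi, |h θ|) ^ 2 ≤ 2 * Real.pi * ∫ θ in 0..2 * Real.pi, h θ ^ 2 := by
  set m := (∫ θ in 0..2 * Real.pi, |h θ|) with hm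
  have hpi := Real.two_pi_pos
  have h0 : 0 ≤ ∫ θ in 0..2 * Real.pi, (2 * Real.pi * |h θ| - m) ^ 2 :=
    intervalIntegral.integral_nonneg hpi.le fun _ _ => sq_nonneg _
  have e : ∀ θ, (2 * Real.pi * |h θ| - m) ^ 2
      = (2 * Real.pi) ^ 2 * h θ ^ 2 - 2 * (2 * Real.pi) * m * |h θ| + m ^ 2 := fun θ => by
    rw [← sq_abs (h θ)]
    ring
  simp_rw [e] at h0
  rw [intervalIntegral.integral_add, intervalIntegral.integral_sub,
    intervalIntegral.integral_const_mul, intervalIntegral.integral_const_mul, ← hm,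
    intervalIntegral.integral_const, smul_eq_mul, sub_zero] at h0
  · have : 0 ≤ 2 * Real.pi * (2 * Real.pi * (∫ θ in 0..2 * Real.pi, h θ ^ 2) - m ^ 2) := by
      nlinarith
    have := nonneg_of_mul_nonneg_right this hpi
    linarith
  all_goals exact Continuous.intervalIntegrable (by fun_prop) _ _

theorem abs_integral_mul_le {f g : ℝ → ℝ} {B : ℝ} (hf : Continuous f) (hg : Continuous g)
    (hB : ∀ θ, |f θ| ≤ B) :
    |∫ θ in 0..2 * Real.pi, f θ * g θ| ≤ B * ∫ θ in 0..2 * Real.pi, |g θ| := by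
  refine (intervalIntegral.abs_integral_le_integral_abs Real.two_pi_pos.le).trans ?_
  rw [← intervalIntegral.integral_const_mul]
  refine intervalIntegral.integral_mono_on Real.two_pi_pos.le
    (Continuous.intervalIntegrable (by fun_prop) _ _)
    (Continuous.intervalIntegrable (by fun_prop) _ _) fun θ _ => ?_
  rw [abs_mul]
  exact mul_le_mul_of_nonneg_right (hB θ) (abs_nonneg _)

/-! ### Two differential inequalities -/

/-- If `A² ≤ c₂ A'` on the half-line, then `A ≤ 0`: a positive value would force blow-up in finite
time. -/
theorem nonpos_of_sq_le_mul_deriv {A j : ℝ → ℝ} {c₂ : ℝ} (hc₂ : 0 < c₂)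
    (hA : ∀ s, 0 < s → HasDerivAt A (j s) s) (h₂ : ∀ s, 0 < s → A s ^ 2 ≤ c₂ * j s)
    {s : ℝ} (hs : 0 < s) : A s ≤ 0 := by
  have hj : ∀ s, 0 < s → 0 ≤ j s := fun s hs =>
    nonneg_of_mul_nonneg_right ((sq_nonneg _).trans (h₂ s hs)) hc₂
  by_contra! hpos
  have hmono : MonotoneOn A (Ici s) := monotoneOn_of_hasDerivWithinAt_nonneg (convex_Ici s)
    (fun x hx => (hA x (hs.trans_le hx)).continuousAt.continuousWithinAt)
    (fun x hx => (hA x (hs.trans (by simpa using hx))).hasDerivWithinAt)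
    (fun x hx => hj x (hs.trans (by simpa using hx)))
  have hApos : ∀ x ∈ Ici s, 0 < A x := fun x hx => hpos.trans_le (hmono self_mem_Ici hx hx)
  -- `-1 / A` grows at least linearly, although it is negative.
  have hd : ∀ x ∈ Ici s, HasDerivAt (fun x => -(A x)⁻¹ - x / c₂) (j x / A x ^ 2 - 1 / c₂) x := by
    intro x hx
    have := ((hA x (hs.trans_le hx)).inv (hApos x hx).ne').neg.sub ((hasDerivAt_id x).div_const c₂)
    refine this.congr_deriv ?_
    ring
  have hmono' : MonotoneOn (fun x => -(A x)⁻¹ - x / c₂) (Ici s) :=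
    monotoneOn_of_hasDerivWithinAt_nonneg (convex_Ici s)
    (fun x hx => (hd x hx).continuousAt.continuousWithinAt)
    (fun x hx => (hd x (interior_subset hx)).hasDerivWithinAt)
    (fun x hx => by
      have hx' : x ∈ Ici s := interior_subset hx
      rw [sub_nonneg, div_le_div_iff₀ hc₂ (pow_pos (hApos x hx') 2)]
      linarith [h₂ x (hs.trans_le hx')])
  have hT : s + c₂ * (A s)⁻¹ ∈ Ici s := by
    have := mul_pos hc₂ (inv_pos.2 hpos)
    rw [mem_Ici]; linarith
  have h := hmono' self_mem_Ici hT hT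
  have hneg := inv_pos.2 (hApos _ hT)
  have e : (s + c₂ * (A s)⁻¹) / c₂ = s / c₂ + (A s)⁻¹ := by field_simp
  simp only [e] at h
  linarith

/-- If moreover `|A| ≤ c₁ A'`, then `A` tends to `0` exponentially. The bound at `s = 2` depends
on `c₂` only, by the Riccati inequality on `[1, 2]`. -/
theorem neg_le_exp_of_sq_le_mul_deriv {A j : ℝ → ℝ} {c₁ c₂ : ℝ} (hc₁ : 0 < c₁) (hc₂ : 0 < c₂)
    (hA : ∀ s, 0 < s → HasDerivAt A (j s) s) (h₁ : ∀ s, 0 < s → |A s| ≤ c₁ * j s)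
    (h₂ : ∀ s, 0 < s → A s ^ 2 ≤ c₂ * j s) {s : ℝ} (hs : 2 ≤ s) :
    -A s ≤ c₂ * Real.exp (-(s - 2) / c₁) := by
  have hj : ∀ s, 0 < s → 0 ≤ j s := fun s hs =>
    nonneg_of_mul_nonneg_right ((sq_nonneg _).trans (h₂ s hs)) hc₂
  have hnonpos : ∀ s, 0 < s → A s ≤ 0 := fun s hs => nonpos_of_sq_le_mul_deriv hc₂ hA h₂ hs
  have hmono : MonotoneOn A (Ici 1) := monotoneOn_of_hasDerivWithinAt_nonneg (convex_Ici 1)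
    (fun x hx => (hA x (one_pos.trans_le hx)).continuousAt.continuousWithinAt)
    (fun x hx => (hA x (one_pos.trans (by simpa using hx))).hasDerivWithinAt)
    (fun x hx => hj x (one_pos.trans (by simpa using hx)))
  have hA2 : -A 2 ≤ c₂ := by
    rcases (hnonpos 2 two_pos).eq_or_lt with h0 | hneg
    · rw [h0]; linarith
    have hAneg : ∀ x ∈ Icc (1 : ℝ) 2, A x < 0 := fun x hx =>
      (hmono hx.1 (by simp) hx.2).trans_lt hneg
    have hx0 : ∀ x ∈ Icc (1 : ℝ) 2, 0 < x := fun x hx => one_pos.trans_le hx.1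
    have hd : ∀ x ∈ Icc (1 : ℝ) 2,
        HasDerivAt (fun x => -(A x)⁻¹ - x / c₂) (j x / A x ^ 2 - 1 / c₂) x := by
      intro x hx
      have := ((hA x (hx0 x hx)).inv (hAneg x hx).ne).neg.sub ((hasDerivAt_id x).div_const c₂)
      refine this.congr_deriv ?_
      ring
    have hmono' : MonotoneOn (fun x => -(A x)⁻¹ - x / c₂) (Icc 1 2) :=
      monotoneOn_of_hasDerivWithinAt_nonneg (convex_Icc 1 2)
      (fun x hx => (hd x hx).continuousAt.continuousWithinAt)
      (fun x hx => (hd x (interior_subset hx)).hasDerivWithinAt)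
      (fun x hx => by
        have hx' : x ∈ Icc (1 : ℝ) 2 := interior_subset hx
        rw [sub_nonneg, div_le_div_iff₀ hc₂ (sq_pos_of_neg (hAneg x hx'))]
        linarith [h₂ x (hx0 x hx')])
    have h := hmono' (by simp) (by simp) one_le_two
    have h1 : (A 1)⁻¹ < 0 := inv_lt_zero.2 (hAneg 1 (by simp))
    have h3 : (1 : ℝ) / c₂ ≤ (-A 2)⁻¹ := by
      rw [inv_neg]
      have : (2 : ℝ) / c₂ = 1 / c₂ + 1 / c₂ := by ring
      simp only [this] at h
      linarith
    rw [one_div] at h3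
    exact (inv_le_inv₀ hc₂ (neg_pos.2 hneg)).1 h3
  have hd : ∀ x ∈ Ici (2 : ℝ), HasDerivAt (fun x => A x * Real.exp ((x - 2) / c₁))
      (j x * Real.exp ((x - 2) / c₁) + A x * (Real.exp ((x - 2) / c₁) * (1 / c₁))) x := by
    intro x hx
    exact (hA x (two_pos.trans_le hx)).mul
      ((((hasDerivAt_id x).sub_const 2).div_const c₁).exp)
  have hmono' : MonotoneOn (fun x => A x * Real.exp ((x - 2) / c₁)) (Ici 2) :=
    monotoneOn_of_hasDerivWithinAt_nonneg (convex_Ici 2)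
    (fun x hx => (hd x hx).continuousAt.continuousWithinAt)
    (fun x hx => (hd x (interior_subset hx)).hasDerivWithinAt)
    (fun x hx => by
      have hx' : (2 : ℝ) ≤ x := interior_subset (s := Ici (2 : ℝ)) hx
      have h := neg_le_of_abs_le (h₁ x (by linarith))
      have : j x * Real.exp ((x - 2) / c₁) + A x * (Real.exp ((x - 2) / c₁) * (1 / c₁))
        = Real.exp ((x - 2) / c₁) * ((c₁ * j x + A x) / c₁) := by field_simp
      rw [this]
      exact mul_nonneg (Real.exp_pos _).le (div_nonneg (by linarith) hc₁.le))
  have h := hmono' self_mem_Ici hs hs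
  simp only [sub_self, zero_div, Real.exp_zero, mul_one] at h
  have e : Real.exp (-(s - 2) / c₁) = (Real.exp ((s - 2) / c₁))⁻¹ := by
    rw [← Real.exp_neg]; ring_nf
  rw [e, ← div_eq_mul_inv, le_div_iff₀ (Real.exp_pos _)]
  linarith

/-! ### Bounded quasiconformal maps of a half-cylinder -/

/-- `(P, Q)` is a `C¹` map of the half-cylinder, bounded by `M` in each component, whose partial
derivatives satisfy the `K`-quasiconformality inequality. -/
structure IsQuasiconformalCylinder (K M : ℝ) (P Ps Pt Q Qs Qt : ℝ → ℝ → ℝ) : Prop where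
  fst : IsC1OnHalfCylinder P Ps Pt
  snd : IsC1OnHalfCylinder Q Qs Qt
  abs_fst_le : ∀ s, 0 < s → ∀ θ, |P s θ| ≤ M
  abs_snd_le : ∀ s, 0 < s → ∀ θ, |Q s θ| ≤ M
  dilatation : ∀ s, 0 < s → ∀ θ,
    Ps s θ ^ 2 + Pt s θ ^ 2 + Qs s θ ^ 2 + Qt s θ ^ 2
      ≤ 2 * K * (Ps s θ * Qt s θ - Pt s θ * Qs s θ)

theorem hasDerivAt_max_zero_sq (x : ℝ) :
    HasDerivAt (fun x : ℝ => max x 0 ^ 2) (2 * max x 0) x := by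
  rcases lt_trichotomy x 0 with h | rfl | h
  · rw [max_eq_right h.le, mul_zero]
    refine (hasDerivAt_const x (0 : ℝ)).congr_of_eventuallyEq ?_
    filter_upwards [Iio_mem_nhds h] with y hy
    rw [max_eq_right (le_of_lt hy)]
    ring
  · rw [max_self, mul_zero, hasDerivAt_iff_isLittleO_nhds_zero]
    have h0 : (fun h : ℝ => h ^ 2) =o[𝓝 0] fun h : ℝ => h := by
      simpa using Asymptotics.isLittleO_pow_id (𝕜 := ℝ) one_lt_two
    refine (Asymptotics.IsBigO.of_bound 1 (Eventually.of_forall fun h => ?_)).trans_isLittleO h0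
    simp only [zero_add, max_self, smul_zero, sub_zero, norm_pow, one_mul, Real.norm_eq_abs,
      ne_eq, OfNat.ofNat_ne_zero, not_false_eq_true, zero_pow]
    refine pow_le_pow_left₀ (abs_nonneg _) ?_ 2
    rw [abs_of_nonneg (le_max_right _ _)]
    exact max_le (le_abs_self h) (abs_nonneg h)
  · rw [max_eq_left h.le]
    refine HasDerivAt.congr_of_eventuallyEq (f := fun y : ℝ => y ^ 2) ?_ ?_
    · simpa using hasDerivAt_pow 2 x
    · filter_upwards [Ioi_mem_nhds h] with y hy
      rw [max_eq_left (le_of_lt hy)]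

theorem IsC1OnHalfCylinder.max_sq {P Ps Pt : ℝ → ℝ → ℝ}
    (h : IsC1OnHalfCylinder P Ps Pt) (k : ℝ) :
    IsC1OnHalfCylinder (fun s θ => max (P s θ - k) 0 ^ 2)
      (fun s θ => 2 * max (P s θ - k) 0 * Ps s θ) (fun s θ => 2 * max (P s θ - k) 0 * Pt s θ) where
  hasDerivAt_left s hs θ :=
    (hasDerivAt_max_zero_sq (P s θ - k)).comp (h₂ := fun x => max x 0 ^ 2) s
      ((h.hasDerivAt_left s hs θ).sub_const k)
  hasDerivAt_right s hs θ :=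
    (hasDerivAt_max_zero_sq (P s θ - k)).comp (h₂ := fun x => max x 0 ^ 2) θ
      ((h.hasDerivAt_right s hs θ).sub_const k)
  continuousOn := ((h.continuousOn.sub continuousOn_const).sup continuousOn_const).pow 2
  continuousOn_left := (continuousOn_const.mul
    ((h.continuousOn.sub continuousOn_const).sup continuousOn_const)).mul h.continuousOn_left
  continuousOn_right := (continuousOn_const.mul
    ((h.continuousOn.sub continuousOn_const).sup continuousOn_const)).mul h.continuousOn_right
  periodic s hs θ := by
    have := h.periodic s hs θ
    simp only [this]

/-- The constant in the oscillation estimate for `K`-quasiconformal maps bounded by `M`. -/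
noncomputable def oscillationConstant (K M : ℝ) : ℝ :=
  (2 + 4 * Real.pi * K) * M * Real.exp (3 / (4 * Real.pi * K))

theorem oscillationConstant_nonneg {K M : ℝ} (hK : 0 < K) (hM : 0 < M) :
    0 ≤ oscillationConstant K M := by
  have := Real.pi_pos
  unfold oscillationConstant
  positivity

namespace IsQuasiconformalCylinder

variable {K M : ℝ} {P Ps Pt Q Qs Qt : ℝ → ℝ → ℝ}

/-- Rotating the target by a right angle exchanges the roles of the components. -/
theorem rotate (h : IsQuasiconformalCylinder K M P Ps Pt Q Qs Qt) :
    IsQuasiconformalCylinder K M Q Qs Qt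
      (fun s θ => -P s θ) (fun s θ => -Ps s θ) (fun s θ => -Pt s θ) where
  fst := h.snd
  snd := h.fst.neg
  abs_fst_le := h.abs_snd_le
  abs_snd_le s hs θ := by rw [abs_neg]; exact h.abs_fst_le s hs θ
  dilatation s hs θ := by linarith [h.dilatation s hs θ]

/-- The integral of the Jacobian over the circle at height `s`. -/
noncomputable def jacobianIntegral (Ps Pt Qs Qt : ℝ → ℝ → ℝ) (s : ℝ) : ℝ :=
  ∫ θ in 0..2 * Real.pi, (Ps s θ * Qt s θ - Pt s θ * Qs s θ)

/-- The signed area `∫ P dQ` enclosed by the image of the circle at height `s`. -/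
noncomputable def signedArea (P Qt : ℝ → ℝ → ℝ) (s : ℝ) : ℝ :=
  ∫ θ in 0..2 * Real.pi, P s θ * Qt s θ

theorem hasDerivAt_signedArea (h : IsQuasiconformalCylinder K M P Ps Pt Q Qs Qt) {s : ℝ}
    (hs : 0 < s) : HasDerivAt (signedArea P Qt) (jacobianIntegral Ps Pt Qs Qt s) s :=
  h.fst.hasDerivAt_circulation h.snd hs

theorem integral_sq_add_sq_le (h : IsQuasiconformalCylinder K M P Ps Pt Q Qs Qt) {s : ℝ}
    (hs : 0 < s) :
    (∫ θ in 0..2 * Real.pi, Pt s θ ^ 2) + ∫ θ in 0..2 * Real.pi, Qt s θ ^ 2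
      ≤ 2 * K * jacobianIntegral Ps Pt Qs Qt s := by
  have c1 := continuous_slice h.fst.continuousOn_left hs
  have c2 := continuous_slice h.fst.continuousOn_right hs
  have c3 := continuous_slice h.snd.continuousOn_left hs
  have c4 := continuous_slice h.snd.continuousOn_right hs
  rw [jacobianIntegral, ← intervalIntegral.integral_const_mul, ← intervalIntegral.integral_add]
  · refine intervalIntegral.integral_mono_on Real.two_pi_pos.le
      (Continuous.intervalIntegrable (by fun_prop) _ _)
      (Continuous.intervalIntegrable (by fun_prop) _ _) fun θ _ => ?_
    nlinarith [h.dilatation s hs θ, sq_nonneg (Ps s θ), sq_nonneg (Qs s θ)]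
  all_goals exact Continuous.intervalIntegrable (by fun_prop) _ _

theorem sq_integral_abs_fst_le (h : IsQuasiconformalCylinder K M P Ps Pt Q Qs Qt) {s : ℝ}
    (hs : 0 < s) :
    (∫ θ in 0..2 * Real.pi, |Pt s θ|) ^ 2
      ≤ 4 * Real.pi * K * jacobianIntegral Ps Pt Qs Qt s := by
  have h1 := sq_integral_abs_le (continuous_slice h.fst.continuousOn_right hs)
  have h2 := h.integral_sq_add_sq_le hs
  have h3 : 0 ≤ ∫ θ in 0..2 * Real.pi, Qt s θ ^ 2 :=
    intervalIntegral.integral_nonneg Real.two_pi_pos.le fun _ _ => sq_nonneg _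
  nlinarith [Real.pi_pos]

theorem sq_integral_abs_snd_le (h : IsQuasiconformalCylinder K M P Ps Pt Q Qs Qt) {s : ℝ}
    (hs : 0 < s) :
    (∫ θ in 0..2 * Real.pi, |Qt s θ|) ^ 2
      ≤ 4 * Real.pi * K * jacobianIntegral Ps Pt Qs Qt s := by
  have h1 := sq_integral_abs_le (continuous_slice h.snd.continuousOn_right hs)
  have h2 := h.integral_sq_add_sq_le hs
  have h3 : 0 ≤ ∫ θ in 0..2 * Real.pi, Pt s θ ^ 2 :=
    intervalIntegral.integral_nonneg Real.two_pi_pos.le fun _ _ => sq_nonneg _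
  nlinarith [Real.pi_pos]

theorem sq_signedArea_le (h : IsQuasiconformalCylinder K M P Ps Pt Q Qs Qt) {s : ℝ}
    (hs : 0 < s) :
    signedArea P Qt s ^ 2 ≤ 4 * Real.pi * K * M ^ 2 * jacobianIntegral Ps Pt Qs Qt s := by
  have h1 := abs_integral_mul_le (continuous_slice h.fst.continuousOn hs)
    (continuous_slice h.snd.continuousOn_right hs) (h.abs_fst_le s hs)
  have h2 := pow_le_pow_left₀ (abs_nonneg _) h1 2
  rw [sq_abs, mul_pow] at h2
  refine h2.trans ?_
  nlinarith [mul_le_mul_of_nonneg_left (h.sq_integral_abs_snd_le hs) (sq_nonneg M)]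

/-- An isoperimetric inequality for the image of a circle (not with the sharp constant). -/
theorem abs_signedArea_le (h : IsQuasiconformalCylinder K M P Ps Pt Q Qs Qt) {s : ℝ}
    (hs : 0 < s) :
    |signedArea P Qt s| ≤ 2 * Real.pi * K * jacobianIntegral Ps Pt Qs Qt s := by
  have cP := continuous_slice h.fst.continuousOn hs
  have cPt := continuous_slice h.fst.continuousOn_right hs
  have cQt := continuous_slice h.snd.continuousOn_right hs
  -- Subtracting a constant from `P` does not change `∫ P dQ`, as the circle is closed.
  have e : signedArea P Qt s = ∫ θ in 0..2 * Real.pi, (P s θ - P s 0) * Qt s θ := by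
    have h0 : ∫ θ in 0..2 * Real.pi, Qt s θ = 0 := by
      rw [h.snd.integral_right_eq_sub hs]
      have := h.snd.periodic s hs 0
      rw [zero_add] at this
      rw [this, sub_self]
    simp_rw [sub_mul]
    rw [intervalIntegral.integral_sub, intervalIntegral.integral_const_mul, h0, mul_zero, sub_zero,
      signedArea]
    all_goals exact Continuous.intervalIntegrable (by fun_prop) _ _
  rw [e]
  refine (abs_integral_mul_le (by fun_prop) cQt fun θ =>
    h.fst.abs_sub_le_integral_abs hs θ 0).trans ?_
  have h1 := sq_integral_abs_le cPt
  have h2 := sq_integral_abs_le cQt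
  have h3 := h.integral_sq_add_sq_le hs
  nlinarith [sq_nonneg ((∫ θ in 0..2 * Real.pi, |Pt s θ|) - ∫ θ in 0..2 * Real.pi, |Qt s θ|),
    mul_le_mul_of_nonneg_left h3 Real.pi_pos.le]

theorem jacobian_nonneg (h : IsQuasiconformalCylinder K M P Ps Pt Q Qs Qt) (hK : 0 < K) {s : ℝ}
    (hs : 0 < s) (θ : ℝ) : 0 ≤ Ps s θ * Qt s θ - Pt s θ * Qs s θ := by
  refine nonneg_of_mul_nonneg_right ?_ (by positivity : (0 : ℝ) < 2 * K)
  exact le_trans (by positivity) (h.dilatation s hs θ)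

/-- Between heights `s` and `s + 1` there is a circle on which the Dirichlet energy is
exponentially small. -/
theorem exists_jacobianIntegral_le (h : IsQuasiconformalCylinder K M P Ps Pt Q Qs Qt)
    (hK : 0 < K) (hM : 0 < M) {s : ℝ} (hs : 2 ≤ s) :
    ∃ σ ∈ Ioo s (s + 1), jacobianIntegral Ps Pt Qs Qt σ
      ≤ 4 * Real.pi * K * M ^ 2 * Real.exp (-(s - 2) / (2 * Real.pi * K)) := by
  have hpi := Real.pi_pos
  have hA : ∀ s, 0 < s → HasDerivAt (signedArea P Qt) (jacobianIntegral Ps Pt Qs Qt s) s :=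
    fun s hs => h.hasDerivAt_signedArea hs
  obtain ⟨σ, hσ, e⟩ := exists_hasDerivAt_eq_slope (signedArea P Qt) (jacobianIntegral Ps Pt Qs Qt)
    (lt_add_one s) (fun x hx => (hA x (by linarith [hx.1])).continuousAt.continuousWithinAt)
    (fun x hx => hA x (by linarith [hx.1]))
  refine ⟨σ, hσ, ?_⟩
  have h1 := nonpos_of_sq_le_mul_deriv (c₂ := 4 * Real.pi * K * M ^ 2) (by positivity) hA
    (fun s hs => h.sq_signedArea_le hs) (by linarith : 0 < s + 1)
  have h2 := neg_le_exp_of_sq_le_mul_deriv (c₁ := 2 * Real.pi * K)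
    (c₂ := 4 * Real.pi * K * M ^ 2) (by positivity) (by positivity) hA
    (fun s hs => h.abs_signedArea_le hs) (fun s hs => h.sq_signedArea_le hs) hs
  rw [e, add_sub_cancel_left, div_one]
  linarith

/-- The maximum principle, including the end at infinity: the supremum of `P` over the part of the
cylinder beyond a circle is attained on that circle. With `f = ((P - k)⁺)²`, the circulation
`∫ f dQ` vanishes on the circle, is nondecreasing, and tends to `0` along circles of small energy,
so the Jacobian, and with it `DP`, vanishes where `P > k`. -/
theorem fst_le_of_circle_le (h : IsQuasiconformalCylinder K M P Ps Pt Q Qs Qt)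
    (hK : 0 < K) (hM : 0 < M) {s₀ k : ℝ} (hs₀ : 0 < s₀) (hk : ∀ θ, P s₀ θ ≤ k) {s : ℝ}
    (hs : s₀ ≤ s) (θ : ℝ) : P s θ ≤ k := by
  have hpi := Real.pi_pos
  have hF := h.fst.max_sq k
  set H : ℝ → ℝ := fun s => ∫ θ in 0..2 * Real.pi, max (P s θ - k) 0 ^ 2 * Qt s θ with hH
  set H' : ℝ → ℝ := fun s => ∫ θ in 0..2 * Real.pi,
    2 * max (P s θ - k) 0 * (Ps s θ * Qt s θ - Pt s θ * Qs s θ) with hH'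
  have hd : ∀ s, 0 < s → HasDerivAt H (H' s) s := fun s hs =>
    (hF.hasDerivAt_circulation h.snd hs).congr_deriv
      (intervalIntegral.integral_congr fun θ _ => by ring)
  have hint : ∀ s, 0 < s → ∀ θ,
      0 ≤ 2 * max (P s θ - k) 0 * (Ps s θ * Qt s θ - Pt s θ * Qs s θ) := fun s hs θ =>
    mul_nonneg (mul_nonneg zero_le_two (le_max_right _ _)) (h.jacobian_nonneg hK hs θ)
  have hmono : MonotoneOn H (Ici s₀) := monotoneOn_of_hasDerivWithinAt_nonneg (convex_Ici s₀)
    (fun x hx => (hd x (hs₀.trans_le hx)).continuousAt.continuousWithinAt)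
    (fun x hx => (hd x (hs₀.trans_le (interior_subset hx))).hasDerivWithinAt)
    (fun x hx => intervalIntegral.integral_nonneg Real.two_pi_pos.le
      fun θ _ => hint x (hs₀.trans_le (interior_subset (s := Ici s₀) hx)) θ)
  have hH0 : H s₀ = 0 := by
    have : ∀ θ, max (P s₀ θ - k) 0 ^ 2 * Qt s₀ θ = 0 := fun θ => by
      rw [max_eq_right (by linarith [hk θ])]
      ring
    simp only [hH, this, intervalIntegral.integral_zero]
  have hsmall : ∀ x, s₀ ≤ x → H x = 0 := by
    intro x hx
    have hHx : 0 ≤ H x := hH0 ▸ hmono self_mem_Ici hx hx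
    set D := ((M + |k|) ^ 2) ^ 2 * (4 * Real.pi * K) * (4 * Real.pi * K * M ^ 2)
    have hbound : ∀ y, max x 2 ≤ y →
        H x ^ 2 ≤ D * Real.exp (-(y - 2) / (2 * Real.pi * K)) := by
      intro y hy
      obtain ⟨σ, hσ, hj⟩ := h.exists_jacobianIntegral_le hK hM (le_of_max_le_right hy)
      have hxσ : x ≤ σ := (le_of_max_le_left hy).trans hσ.1.le
      have hσ0 : 0 < σ := by linarith
      have hle : H x ≤ H σ := hmono hx (hx.trans hxσ) hxσ
      have h1 : |H σ| ≤ (M + |k|) ^ 2 * ∫ θ in 0..2 * Real.pi, |Qt σ θ| := by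
        refine abs_integral_mul_le
          (continuous_slice (f := fun s θ => max (P s θ - k) 0 ^ 2) hF.continuousOn hσ0)
          (continuous_slice h.snd.continuousOn_right hσ0) fun θ => ?_
        rw [abs_of_nonneg (sq_nonneg _)]
        refine pow_le_pow_left₀ (le_max_right _ _) (max_le ?_ (by positivity)) 2
        linarith [le_of_abs_le (h.abs_fst_le σ hσ0 θ), neg_abs_le k]
      have h2 := pow_le_pow_left₀ hHx (hle.trans ((le_abs_self _).trans h1)) 2
      rw [mul_pow] at h2
      refine h2.trans ?_
      calc ((M + |k|) ^ 2) ^ 2 * (∫ θ in 0..2 * Real.pi, |Qt σ θ|) ^ 2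
          ≤ ((M + |k|) ^ 2) ^ 2 * (4 * Real.pi * K * (4 * Real.pi * K * M ^ 2
              * Real.exp (-(y - 2) / (2 * Real.pi * K)))) := by
            refine mul_le_mul_of_nonneg_left ((h.sq_integral_abs_snd_le hσ0).trans ?_)
              (by positivity)
            exact mul_le_mul_of_nonneg_left hj (by positivity)
        _ = _ := by ring
    have hlim : Tendsto (fun y : ℝ => D * Real.exp (-(y - 2) / (2 * Real.pi * K))) atTop
        (𝓝 (D * 0)) := by
      refine Tendsto.const_mul D (Real.tendsto_exp_atBot.comp ?_)
      refine Tendsto.atBot_div_const (by positivity) (tendsto_neg_atTop_atBot.comp ?_)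
      exact tendsto_atTop_add_const_right _ (-2) tendsto_id
    have := ge_of_tendsto hlim ((eventually_ge_atTop _).mono hbound)
    rw [mul_zero] at this
    exact pow_eq_zero_iff two_ne_zero |>.1 (le_antisymm this (sq_nonneg _))
  have hH'0 : ∀ x, s₀ < x → H' x = 0 := by
    intro x hx
    have : HasDerivAt H 0 x := (hasDerivAt_const x (0 : ℝ)).congr_of_eventuallyEq <| by
      filter_upwards [Ioi_mem_nhds hx] with y hy using hsmall y (le_of_lt hy)
    exact (hd x (hs₀.trans hx)).unique this
  -- The axial derivative of `((P - k)⁺)²` vanishes beyond the circle.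
  have hder : ∀ x, s₀ < x → ∀ θ ∈ Icc 0 (2 * Real.pi), 2 * max (P x θ - k) 0 * Ps x θ = 0 := by
    intro x hx θ hθ
    have hx0 : 0 < x := hs₀.trans hx
    have hzero : 2 * max (P x θ - k) 0 * (Ps x θ * Qt x θ - Pt x θ * Qs x θ) = 0 := by
      by_contra hne
      have c0 := continuous_slice h.fst.continuousOn hx0
      have c1 := continuous_slice h.fst.continuousOn_left hx0
      have c2 := continuous_slice h.fst.continuousOn_right hx0
      have c3 := continuous_slice h.snd.continuousOn_left hx0
      have c4 := continuous_slice h.snd.continuousOn_right hx0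
      refine (intervalIntegral.integral_pos Real.two_pi_pos (Continuous.continuousOn (by fun_prop))
        (fun θ _ => hint x hx0 θ) ⟨θ, hθ, lt_of_le_of_ne (hint x hx0 θ) (Ne.symm hne)⟩).ne'
        (hH'0 x hx)
    rcases mul_eq_zero.1 hzero with h0 | h0
    · rw [h0, zero_mul]
    · have h1 := h.dilatation x hx0 θ
      rw [h0, mul_zero] at h1
      have : Ps x θ = 0 := by
        nlinarith [sq_nonneg (Ps x θ), sq_nonneg (Pt x θ), sq_nonneg (Qs x θ), sq_nonneg (Qt x θ)]
      rw [this, mul_zero]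
  have hs0 : 0 < s := hs₀.trans_le hs
  obtain ⟨θ', hθ', e⟩ := (h.fst.periodic s hs0).exists_mem_Ico₀ Real.two_pi_pos θ
  rw [e]
  have hconst : max (P s θ' - k) 0 ^ 2 = max (P s₀ θ' - k) 0 ^ 2 :=
    constant_of_has_deriv_right_zero (f := fun s => max (P s θ' - k) 0 ^ 2) (a := s₀) (b := s)
      (fun x hx => (hF.hasDerivAt_left x (hs₀.trans_le hx.1) θ').continuousAt.continuousWithinAt)
      (fun x hx => by
        rcases hx.1.eq_or_lt with rfl | hlt
        · have := hF.hasDerivAt_left s₀ hs₀ θ'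
          rw [max_eq_right (by linarith [hk θ']), mul_zero, zero_mul] at this
          exact this.hasDerivWithinAt
        · have := hF.hasDerivAt_left x (hs₀.trans hlt) θ'
          rw [hder x hlt θ' (Ico_subset_Icc_self hθ')] at this
          exact this.hasDerivWithinAt) s ⟨hs, le_rfl⟩
  rw [max_eq_right (by linarith [hk θ'] : P s₀ θ' - k ≤ 0), zero_pow two_ne_zero,
    pow_eq_zero_iff two_ne_zero, max_eq_right_iff] at hconst
  linarith

/-- Beyond a circle, the oscillation of `P` is at most its total variation on that circle. -/
theorem abs_fst_sub_le (h : IsQuasiconformalCylinder K M P Ps Pt Q Qs Qt)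
    (hK : 0 < K) (hM : 0 < M) {σ s₁ s₂ : ℝ} (hσ : 0 < σ) (h₁ : σ ≤ s₁) (h₂ : σ ≤ s₂)
    (θ₁ θ₂ : ℝ) : |P s₁ θ₁ - P s₂ θ₂| ≤ ∫ θ in 0..2 * Real.pi, |Pt σ θ| := by
  have hV := h.fst.abs_sub_le_integral_abs hσ
  obtain ⟨c, -, hc⟩ := isCompact_Icc.exists_isMaxOn (nonempty_Icc.2 Real.two_pi_pos.le)
    (continuous_slice h.fst.continuousOn hσ).continuousOn
  have hmax : ∀ θ, P σ θ ≤ P σ c := fun θ => by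
    obtain ⟨θ', hθ', e⟩ := (h.fst.periodic σ hσ).exists_mem_Ico₀ Real.two_pi_pos θ
    rw [e]
    exact hc (Ico_subset_Icc_self hθ')
  have hmin : ∀ θ, -P σ θ ≤ (∫ θ in 0..2 * Real.pi, |Pt σ θ|) - P σ c := fun θ => by
    linarith [le_of_abs_le (hV c θ)]
  have up : ∀ s, σ ≤ s → ∀ θ, P s θ ≤ P σ c := fun s hs θ =>
    h.fst_le_of_circle_le hK hM hσ hmax hs θ
  have lo : ∀ s, σ ≤ s → ∀ θ, -P s θ ≤ (∫ θ in 0..2 * Real.pi, |Pt σ θ|) - P σ c := fun s hs θ =>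
    h.rotate.rotate.fst_le_of_circle_le hK hM hσ hmin hs θ
  rw [abs_le]
  constructor <;> linarith [up s₁ h₁ θ₁, up s₂ h₂ θ₂, lo s₁ h₁ θ₁, lo s₂ h₂ θ₂]

/-- The oscillation of `P` beyond height `s` decays exponentially, at a rate depending on `K`
only. -/
theorem abs_fst_sub_le_exp (h : IsQuasiconformalCylinder K M P Ps Pt Q Qs Qt)
    (hK : 0 < K) (hM : 0 < M) {s s₁ s₂ : ℝ} (hs : 0 < s) (h₁ : s ≤ s₁) (h₂ : s ≤ s₂)
    (θ₁ θ₂ : ℝ) :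
    |P s₁ θ₁ - P s₂ θ₂| ≤ oscillationConstant K M * Real.exp (-s / (4 * Real.pi * K)) := by
  have hpi := Real.pi_pos
  rw [oscillationConstant, mul_assoc, ← Real.exp_add, ← add_div]
  -- The exponential bound on the energy is available from height `2` on, so it yields a good circle
  -- below `s` once `s ≥ 3`; for smaller `s` the bound `2 * M` suffices.
  rcases le_or_gt 3 s with h3 | h3
  · obtain ⟨σ, hσ, hj⟩ := h.exists_jacobianIntegral_le hK hM (by linarith : 2 ≤ s - 1)
    have hσ0 : 0 < σ := by linarith [hσ.1]
    have hσs : σ ≤ s := by linarith [hσ.2]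
    refine (h.abs_fst_sub_le hK hM hσ0 (hσs.trans h₁) (hσs.trans h₂) θ₁ θ₂).trans ?_
    have hsq : (∫ θ in 0..2 * Real.pi, |Pt σ θ|) ^ 2
        ≤ (4 * Real.pi * K * M * Real.exp ((3 + -s) / (4 * Real.pi * K))) ^ 2 := by
      refine (h.sq_integral_abs_fst_le hσ0).trans
        ((mul_le_mul_of_nonneg_left hj (by positivity)).trans_eq ?_)
      rw [mul_pow _ (Real.exp _), ← Real.exp_nat_mul]
      have : -(s - 1 - 2) / (2 * Real.pi * K) = ((2 : ℕ) : ℝ) * ((3 + -s) / (4 * Real.pi * K)) := by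
        field_simp
        push_cast
        ring
      rw [this]
      ring
    refine (pow_le_pow_iff_left₀ (intervalIntegral.integral_nonneg Real.two_pi_pos.le
      fun _ _ => abs_nonneg _) (by positivity) two_ne_zero).1 hsq |>.trans ?_
    have : 0 ≤ 2 * M * Real.exp ((3 + -s) / (4 * Real.pi * K)) := by positivity
    linarith
  · have h1 : |P s₁ θ₁ - P s₂ θ₂| ≤ 2 * M := by
      refine (abs_sub _ _).trans ?_
      linarith [h.abs_fst_le s₁ (by linarith) θ₁, h.abs_fst_le s₂ (by linarith) θ₂]
    have h2 : 1 ≤ Real.exp ((3 + -s) / (4 * Real.pi * K)) :=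
      Real.one_le_exp (div_nonneg (by linarith) (by positivity))
    refine h1.trans (le_trans ?_ (le_mul_of_one_le_right (by positivity) h2))
    have : 0 ≤ 4 * Real.pi * K * M := by positivity
    linarith

end IsQuasiconformalCylinder

/-! ### Log-polar coordinates -/

/-- Log-polar coordinates about `x₀`: the point at distance `r * exp (ε * s)` from `x₀` in the
direction of angle `θ`. The half-cylinder `s > 0` parametrizes the punctured disc of radius `r`
for `ε = -1` and its exterior for `ε = 1`. -/
noncomputable def logPolar (x₀ : Plane) (r ε s θ : ℝ) : Plane :=
  x₀ + (r * Real.exp (ε * s)) •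
    (Real.cos θ • EuclideanSpace.single (0 : Fin 2) (1 : ℝ)
      + Real.sin θ • EuclideanSpace.single (1 : Fin 2) (1 : ℝ))

theorem norm_cos_smul_add_sin_smul (θ : ℝ) :
    ‖Real.cos θ • EuclideanSpace.single (0 : Fin 2) (1 : ℝ)
      + Real.sin θ • EuclideanSpace.single (1 : Fin 2) (1 : ℝ)‖ = 1 := by
  simp [EuclideanSpace.norm_eq]

theorem norm_logPolar_sub {r : ℝ} (hr : 0 < r) (x₀ : Plane) (ε s θ : ℝ) :
    ‖logPolar x₀ r ε s θ - x₀‖ = r * Real.exp (ε * s) := by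
  rw [logPolar, add_sub_cancel_left, norm_smul, norm_cos_smul_add_sin_smul, mul_one,
    Real.norm_of_nonneg (by positivity)]

theorem exists_logPolar_eq {r : ℝ} {x₀ x : Plane} {ε s : ℝ}
    (h : ‖x - x₀‖ = r * Real.exp (ε * s)) : ∃ θ, logPolar x₀ r ε s θ = x := by
  set z : ℂ := ⟨(x - x₀) 0, (x - x₀) 1⟩ with hz
  have hn : ‖z‖ = ‖x - x₀‖ := by
    rw [Complex.norm_def, Complex.normSq_apply, EuclideanSpace.norm_eq, Fin.sum_univ_two]
    simp [hz, sq]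
  refine ⟨z.arg, ?_⟩
  rw [logPolar, ← h, ← hn, ← eq_sub_iff_add_eq']
  ext i
  fin_cases i
  · simp [hz]
  · simp [hz]

theorem fderiv_comb (f : Plane → ℝ) (x : Plane) (a b c : ℝ) :
    fderiv ℝ f x (c • (a • EuclideanSpace.single (0 : Fin 2) (1 : ℝ)
      + b • EuclideanSpace.single (1 : Fin 2) (1 : ℝ)))
      = c * (a * partialDeriv 0 f x + b * partialDeriv 1 f x) := by
  simp [partialDeriv, mul_add]

theorem continuousOn_partialDeriv {f : Plane → ℝ} {U : Set Plane} (hU : IsOpen U)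
    (hf : ContDiffOn ℝ 1 f U) (i : Fin 2) : ContinuousOn (partialDeriv i f) U :=
  (hf.continuousOn_fderiv_of_isOpen hU le_rfl).clm_apply continuousOn_const

theorem continuous_logPolar (x₀ : Plane) (r ε : ℝ) :
    Continuous fun z : ℝ × ℝ => logPolar x₀ r ε z.1 z.2 := by
  unfold logPolar
  fun_prop

theorem isC1OnHalfCylinder_comp_logPolar {f : Plane → ℝ} {U : Set Plane} (hU : IsOpen U)
    (hf : ContDiffOn ℝ 1 f U) {x₀ : Plane} {r ε : ℝ}
    (hmaps : ∀ s, 0 < s → ∀ θ, logPolar x₀ r ε s θ ∈ U) :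
    IsC1OnHalfCylinder (fun s θ => f (logPolar x₀ r ε s θ))
      (fun s θ => ε * (r * Real.exp (ε * s))
        * (Real.cos θ * partialDeriv 0 f (logPolar x₀ r ε s θ)
          + Real.sin θ * partialDeriv 1 f (logPolar x₀ r ε s θ)))
      (fun s θ => (r * Real.exp (ε * s))
        * (-Real.sin θ * partialDeriv 0 f (logPolar x₀ r ε s θ)
          + Real.cos θ * partialDeriv 1 f (logPolar x₀ r ε s θ))) := by
  have hd : ∀ s, 0 < s → ∀ θ, HasFDerivAt f (fderiv ℝ f (logPolar x₀ r ε s θ))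
      (logPolar x₀ r ε s θ) := fun s hs θ =>
    ((hf.contDiffAt (hU.mem_nhds (hmaps s hs θ))).differentiableAt one_ne_zero).hasFDerivAt
  have hm : MapsTo (fun z : ℝ × ℝ => logPolar x₀ r ε z.1 z.2) (Ioi 0 ×ˢ univ) U :=
    fun z hz => hmaps z.1 hz.1 z.2
  have hc := (continuous_logPolar x₀ r ε).continuousOn (s := Ioi 0 ×ˢ univ)
  have c0 := (continuousOn_partialDeriv hU hf 0).comp hc hm
  have c1 := (continuousOn_partialDeriv hU hf 1).comp hc hm
  constructor
  · intro s hs θ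
    rw [← fderiv_comb]
    refine (hd s hs θ).comp_hasDerivAt s ?_
    have he : HasDerivAt (fun σ => r * Real.exp (ε * σ)) (ε * (r * Real.exp (ε * s))) s :=
      (((hasDerivAt_id s).const_mul ε).exp.const_mul r).congr_deriv (by simp; ring)
    exact (he.smul_const _).const_add x₀
  · intro s hs θ
    rw [← fderiv_comb]
    refine (hd s hs θ).comp_hasDerivAt θ ?_
    exact ((((Real.hasDerivAt_cos θ).smul_const _).add
      ((Real.hasDerivAt_sin θ).smul_const _)).const_smul (r * Real.exp (ε * s))).const_add x₀
  · exact hf.continuousOn.comp hc hm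
  · refine ContinuousOn.mul (Continuous.continuousOn (by fun_prop)) (ContinuousOn.add ?_ ?_)
    · exact (Continuous.continuousOn (by fun_prop)).mul c0
    · exact (Continuous.continuousOn (by fun_prop)).mul c1
  · refine ContinuousOn.mul (Continuous.continuousOn (by fun_prop)) (ContinuousOn.add ?_ ?_)
    · exact (Continuous.continuousOn (by fun_prop)).mul c0
    · exact (Continuous.continuousOn (by fun_prop)).mul c1
  · intro s hs θ
    simp only [logPolar, Real.cos_add_two_pi, Real.sin_add_two_pi]

/-- A quasiconformal map in log-polar coordinates is quasiconformal. The coordinates preserve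
orientation for `ε = 1` and reverse it for `ε = -1`, whence the sign in the hypothesis. -/
theorem exists_isQuasiconformalCylinder {K M ε : ℝ} {p q : Plane → ℝ} {U : Set Plane}
    (hU : IsOpen U) (hpU : ContDiffOn ℝ 1 p U) (hqU : ContDiffOn ℝ 1 q U) (hε : ε ^ 2 = 1)
    (h : ∀ x ∈ U, partialDeriv 0 p x ^ 2 + partialDeriv 1 p x ^ 2
          + partialDeriv 0 q x ^ 2 + partialDeriv 1 q x ^ 2
        ≤ 2 * K * (ε * (partialDeriv 0 p x * partialDeriv 1 q x
            - partialDeriv 1 p x * partialDeriv 0 q x)))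
    (hp : ∀ x ∈ U, |p x| ≤ M) (hq : ∀ x ∈ U, |q x| ≤ M) {x₀ : Plane} {r : ℝ}
    (hmaps : ∀ s, 0 < s → ∀ θ, logPolar x₀ r ε s θ ∈ U) :
    ∃ Ps Pt Qs Qt, IsQuasiconformalCylinder K M (fun s θ => p (logPolar x₀ r ε s θ)) Ps Pt
      (fun s θ => q (logPolar x₀ r ε s θ)) Qs Qt := by
  refine ⟨_, _, _, _, isC1OnHalfCylinder_comp_logPolar hU hpU hmaps,
    isC1OnHalfCylinder_comp_logPolar hU hqU hmaps, fun s hs θ => hp _ (hmaps s hs θ),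
    fun s hs θ => hq _ (hmaps s hs θ), fun s hs θ => ?_⟩
  have hqc := mul_le_mul_of_nonneg_left (h _ (hmaps s hs θ)) (sq_nonneg (r * Real.exp (ε * s)))
  have hsc := Real.sin_sq_add_cos_sq θ
  generalize r * Real.exp (ε * s) = ρ at hqc ⊢
  generalize partialDeriv 0 p (logPolar x₀ r ε s θ) = a at hqc ⊢
  generalize partialDeriv 1 p (logPolar x₀ r ε s θ) = b at hqc ⊢
  generalize partialDeriv 0 q (logPolar x₀ r ε s θ) = c at hqc ⊢
  generalize partialDeriv 1 q (logPolar x₀ r ε s θ) = d at hqc ⊢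
  have energy : ∀ a b : ℝ, (ε * ρ * (Real.cos θ * a + Real.sin θ * b)) ^ 2
      + (ρ * (-Real.sin θ * a + Real.cos θ * b)) ^ 2 = ρ ^ 2 * (a ^ 2 + b ^ 2) := fun a b => by
    linear_combination (ρ ^ 2 * (Real.cos θ * a + Real.sin θ * b) ^ 2) * hε
      + ρ ^ 2 * (a ^ 2 + b ^ 2) * hsc
  have jacobian : ε * ρ * (Real.cos θ * a + Real.sin θ * b)
        * (ρ * (-Real.sin θ * c + Real.cos θ * d))
      - ρ * (-Real.sin θ * a + Real.cos θ * b) * (ε * ρ * (Real.cos θ * c + Real.sin θ * d))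
      = ρ ^ 2 * (ε * (a * d - b * c)) := by
    linear_combination ε * ρ ^ 2 * (a * d - b * c) * hsc
  rw [jacobian]
  linarith [energy a b, energy c d]

/-! ### Oscillation of quasiconformal maps in the plane -/

/-- The Hölder exponent of bounded `K`-quasiconformal maps. -/
noncomputable def holderExponent (K : ℝ) : ℝ := 1 / (4 * Real.pi * K)

theorem exp_rpow_eq {K t : ℝ} :
    Real.exp t ^ (holderExponent K) = Real.exp (t / (4 * Real.pi * K)) := by
  rw [← Real.exp_mul, holderExponent, mul_one_div]

theorem IsQuasiconformalOn.abs_sub_le_of_ball {K M r : ℝ} {p q : Plane → ℝ} {x₀ : Plane}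
    (hK : 0 < K) (hM : 0 < M) (h : IsQuasiconformalOn K (Metric.ball x₀ r) p q)
    (hp : ∀ x ∈ Metric.ball x₀ r, |p x| ≤ M) (hq : ∀ x ∈ Metric.ball x₀ r, |q x| ≤ M)
    {x : Plane} (hx : x ∈ Metric.ball x₀ r) :
    |p x - p x₀| ≤ oscillationConstant K M * (‖x - x₀‖ / r) ^ holderExponent K ∧
    |q x - q x₀| ≤ oscillationConstant K M * (‖x - x₀‖ / r) ^ holderExponent K := by
  have hr : 0 < r := Metric.pos_of_mem_ball hx
  have hC := oscillationConstant_nonneg hK hM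
  rcases eq_or_ne x x₀ with rfl | hne
  · simp only [sub_self, abs_zero]
    exact ⟨by positivity, by positivity⟩
  have hn : 0 < ‖x - x₀‖ := norm_pos_iff.2 (sub_ne_zero.2 hne)
  have hlt : ‖x - x₀‖ / r < 1 := by
    rw [div_lt_one hr, ← dist_eq_norm]
    exact hx
  set s := -Real.log (‖x - x₀‖ / r) with hs
  have hs0 : 0 < s := neg_pos.2 (Real.log_neg (by positivity) hlt)
  have hexp : Real.exp (-s) = ‖x - x₀‖ / r := by
    rw [hs, neg_neg, Real.exp_log (by positivity)]
  obtain ⟨θ, hθ⟩ := exists_logPolar_eq (x₀ := x₀) (x := x) (r := r) (ε := -1) (s := s) (by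
    rw [neg_one_mul, hexp]
    field_simp)
  have hmaps : ∀ s, 0 < s → ∀ θ, logPolar x₀ r (-1) s θ ∈ Metric.ball x₀ r := by
    intro s hs θ
    rw [mem_ball_iff_norm, norm_logPolar_sub hr]
    exact mul_lt_of_lt_one_right hr (Real.exp_lt_one_iff.2 (by linarith))
  obtain ⟨_, _, _, _, hcyl⟩ := exists_isQuasiconformalCylinder (K := K) Metric.isOpen_ball h.2.1 h.1
    (by norm_num : (-1 : ℝ) ^ 2 = 1) (fun x hx => by linarith [h.2.2 x hx]) hq hp hmaps
  have hlim : Tendsto (fun σ => logPolar x₀ r (-1) σ 0) atTop (𝓝 x₀) := by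
    rw [tendsto_iff_norm_sub_tendsto_zero]
    simp_rw [norm_logPolar_sub hr]
    have : Tendsto (fun σ : ℝ => r * Real.exp (-1 * σ)) atTop (𝓝 (r * 0)) := by
      simp_rw [neg_one_mul]
      exact Real.tendsto_exp_neg_atTop_nhds_zero.const_mul r
    rwa [mul_zero] at this
  have hx₀ : x₀ ∈ Metric.ball x₀ r := Metric.mem_ball_self hr
  have hcont : ∀ f : Plane → ℝ, ContDiffOn ℝ 1 f (Metric.ball x₀ r) →
      Tendsto (fun σ => |f x - f (logPolar x₀ r (-1) σ 0)|) atTop (𝓝 |f x - f x₀|) := fun f hf =>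
    (((hf.continuousOn.continuousAt (Metric.isOpen_ball.mem_nhds hx₀)).tendsto.comp
      hlim).const_sub (f x)).abs
  rw [← hexp, exp_rpow_eq]
  refine ⟨le_of_tendsto (hcont p h.1) ?_, le_of_tendsto (hcont q h.2.1) ?_⟩
  · filter_upwards [eventually_ge_atTop s] with σ hσ
    have := hcyl.rotate.rotate.rotate.abs_fst_sub_le_exp hK hM hs0 le_rfl hσ θ 0
    simpa only [hθ, neg_sub_neg, abs_sub_comm] using this
  · filter_upwards [eventually_ge_atTop s] with σ hσ
    have := hcyl.abs_fst_sub_le_exp hK hM hs0 le_rfl hσ θ 0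
    simpa only [hθ] using this

theorem IsQuasiconformalOn.abs_sub_le_of_exterior {K M r : ℝ} {p q : Plane → ℝ} (hr : 0 < r)
    (hK : 0 < K) (hM : 0 < M) (h : IsQuasiconformalOn K (Metric.closedBall 0 r)ᶜ p q)
    (hp : ∀ x ∈ (Metric.closedBall 0 r)ᶜ, |p x| ≤ M)
    (hq : ∀ x ∈ (Metric.closedBall 0 r)ᶜ, |q x| ≤ M)
    {x y : Plane} (hx : r < ‖x‖) (hxy : ‖x‖ ≤ ‖y‖) :
    |p x - p y| ≤ oscillationConstant K M * (‖x‖ / r) ^ (-holderExponent K) ∧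
    |q x - q y| ≤ oscillationConstant K M * (‖x‖ / r) ^ (-holderExponent K) := by
  have hx0 : 0 < ‖x‖ := hr.trans hx
  have hy0 : 0 < ‖y‖ := hx0.trans_le hxy
  have hcoord : ∀ z : Plane, 0 < ‖z‖ → ∃ θ, logPolar 0 r 1 (Real.log (‖z‖ / r)) θ = z := by
    intro z hz
    refine exists_logPolar_eq ?_
    rw [one_mul, Real.exp_log (by positivity), sub_zero]
    field_simp
  obtain ⟨θ₁, h₁⟩ := hcoord x hx0
  obtain ⟨θ₂, h₂⟩ := hcoord y hy0
  have hs : 0 < Real.log (‖x‖ / r) := Real.log_pos ((one_lt_div hr).2 hx)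
  have hst : Real.log (‖x‖ / r) ≤ Real.log (‖y‖ / r) :=
    Real.log_le_log (by positivity) (by gcongr)
  have hmaps : ∀ s, 0 < s → ∀ θ, logPolar 0 r 1 s θ ∈ (Metric.closedBall (0 : Plane) r)ᶜ := by
    intro s hs θ
    rw [mem_compl_iff, mem_closedBall_iff_norm, norm_logPolar_sub hr, not_le]
    exact lt_mul_of_one_lt_right hr (Real.one_lt_exp_iff.2 (by linarith))
  obtain ⟨_, _, _, _, hcyl⟩ := exists_isQuasiconformalCylinder (K := K)
    Metric.isClosed_closedBall.isOpen_compl h.1 h.2.1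
    (by norm_num : (1 : ℝ) ^ 2 = 1) (fun x hx => by linarith [h.2.2 x hx]) hp hq hmaps
  have e : (‖x‖ / r) ^ (-holderExponent K)
      = Real.exp (-Real.log (‖x‖ / r) / (4 * Real.pi * K)) := by
    rw [← exp_rpow_eq, Real.exp_neg, Real.exp_log (by positivity), Real.rpow_neg (by positivity),
      Real.inv_rpow (by positivity)]
  rw [e]
  constructor
  · simpa only [h₁, h₂] using hcyl.abs_fst_sub_le_exp hK hM hs le_rfl hst θ₁ θ₂
  · simpa only [h₁, h₂] using hcyl.rotate.abs_fst_sub_le_exp hK hM hs le_rfl hst θ₁ θ₂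

/-! ### The gradient of a solution -/

theorem gradient_apply (u : Plane → ℝ) (x : Plane) (i : Fin 2) :
    gradient u x i = partialDeriv i u x := by
  have h : inner ℝ (gradient u x) (EuclideanSpace.single i (1 : ℝ)) = partialDeriv i u x := by
    simp [gradient, partialDeriv]
  rw [← h, EuclideanSpace.inner_single_right]
  simp

theorem abs_partialDeriv_le_norm_gradient (u : Plane → ℝ) (x : Plane) (i : Fin 2) :
    |partialDeriv i u x| ≤ ‖gradient u x‖ := by
  rw [← gradient_apply, ← Real.norm_eq_abs]
  exact PiLp.norm_apply_le _ i

theorem norm_gradient_sub_le {u : Plane → ℝ} {x y : Plane} {B : ℝ}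
    (h₁ : |partialDeriv 1 u x - partialDeriv 1 u y| ≤ B)
    (h₀ : |partialDeriv 0 u x - partialDeriv 0 u y| ≤ B) :
    ‖gradient u x - gradient u y‖ ≤ 2 * B := by
  have hB : 0 ≤ B := (abs_nonneg _).trans h₀
  rw [EuclideanSpace.norm_eq, Fin.sum_univ_two]
  refine Real.sqrt_le_iff.2 ⟨by positivity, ?_⟩
  simp only [PiLp.sub_apply, gradient_apply, Real.norm_eq_abs]
  nlinarith [abs_nonneg (partialDeriv 0 u x - partialDeriv 0 u y),
    abs_nonneg (partialDeriv 1 u x - partialDeriv 1 u y)]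

theorem contDiffOn_partialDeriv {u : Plane → ℝ} {U : Set Plane} (hU : IsOpen U)
    (hu : ContDiffOn ℝ 2 u U) (i : Fin 2) : ContDiffOn ℝ 1 (partialDeriv i u) U :=
  (hu.fderiv_of_isOpen (m := 1) hU (by norm_num)).clm_apply contDiffOn_const

theorem partialDeriv_partialDeriv {u : Plane → ℝ} {x : Plane} (hu : ContDiffAt ℝ 2 u x)
    (i j : Fin 2) : partialDeriv i (partialDeriv j u) x
      = fderiv ℝ (fderiv ℝ u) x (EuclideanSpace.single i 1) (EuclideanSpace.single j 1) := by
  have hd : DifferentiableAt ℝ (fderiv ℝ u) x :=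
    (hu.fderiv_right (m := 1) (by norm_num)).differentiableAt one_ne_zero
  change fderiv ℝ (fun y => fderiv ℝ u y (EuclideanSpace.single j 1)) x _ = _
  rw [fderiv_clm_apply hd (differentiableAt_const _)]
  simp

theorem partialDeriv_comm {u : Plane → ℝ} {x : Plane} (hu : ContDiffAt ℝ 2 u x)
    (i j : Fin 2) : partialDeriv i (partialDeriv j u) x = partialDeriv j (partialDeriv i u) x := by
  rw [partialDeriv_partialDeriv hu, partialDeriv_partialDeriv hu]
  exact hu.isSymmSndFDerivAt (by simp) _ _

/-- If a positive definite form with matrix `(a, b; b, c)` and eigenvalue ratio at most `γ` is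
trace-orthogonal to the symmetric matrix `(r, s; s, t)`, then the latter satisfies the
quasiconformality inequality with `K = (1 + γ) / 2`. -/
theorem sq_add_sq_le_of_elliptic {γ lam Lam a b c r s t : ℝ} (hlam : 0 < lam) (hγ : Lam / lam ≤ γ)
    (h : ∀ ξ₁ ξ₂ : ℝ, lam * (ξ₁ ^ 2 + ξ₂ ^ 2) ≤ a * ξ₁ ^ 2 + 2 * b * ξ₁ * ξ₂ + c * ξ₂ ^ 2 ∧
      a * ξ₁ ^ 2 + 2 * b * ξ₁ * ξ₂ + c * ξ₂ ^ 2 ≤ Lam * (ξ₁ ^ 2 + ξ₂ ^ 2))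
    (htr : a * r + 2 * b * s + c * t = 0) :
    r ^ 2 + 2 * s ^ 2 + t ^ 2 ≤ (1 + γ) * (s ^ 2 - r * t) := by
  rw [div_le_iff₀ hlam] at hγ
  have hlL : lam ≤ Lam := by nlinarith [h 1 0]
  have hγ0 : 0 ≤ γ := by
    by_contra! hneg
    nlinarith
  -- The values of the form at `ξ` and at `ξ` turned by a right angle add up to
  -- `(a + c) |ξ|²`, and the second is at most `γ` times the first.
  have key : ∀ ξ₁ ξ₂ : ℝ, (a + c) * (ξ₁ ^ 2 + ξ₂ ^ 2)
      ≤ (1 + γ) * (a * ξ₁ ^ 2 + 2 * b * ξ₁ * ξ₂ + c * ξ₂ ^ 2) := by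
    intro ξ₁ ξ₂
    have h1 := (h (-ξ₂) ξ₁).2
    have h2 := mul_le_mul_of_nonneg_left (h ξ₁ ξ₂).1 hγ0
    have h3 := mul_le_mul_of_nonneg_right hγ (by positivity : 0 ≤ ξ₁ ^ 2 + ξ₂ ^ 2)
    nlinarith
  have hpos : 0 < a + c := by nlinarith [(h 1 0).1, (h 0 1).1]
  refine le_of_mul_le_mul_left ?_ hpos
  have e : (a * r ^ 2 + 2 * b * r * s + c * s ^ 2) + (a * s ^ 2 + 2 * b * s * t + c * t ^ 2)
      = (a + c) * (s ^ 2 - r * t) := by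
    linear_combination (r + t) * htr
  calc (a + c) * (r ^ 2 + 2 * s ^ 2 + t ^ 2)
      ≤ (1 + γ) * ((a * r ^ 2 + 2 * b * r * s + c * s ^ 2)
          + (a * s ^ 2 + 2 * b * s * t + c * t ^ 2)) := by linarith [key r s, key s t]
    _ = (a + c) * ((1 + γ) * (s ^ 2 - r * t)) := by rw [e]; ring

theorem isQuasiconformalOn_of_isClassicalSolution {γ : ℝ} {U : Set Plane}
    {a₁₁ a₁₂ a₂₂ u : Plane → ℝ} (hU : IsOpen U) (ha : IsUniformlyElliptic γ U a₁₁ a₁₂ a₂₂)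
    (hu : IsClassicalSolution U a₁₁ a₁₂ a₂₂ u) :
    IsQuasiconformalOn ((1 + γ) / 2) U (partialDeriv 1 u) (partialDeriv 0 u) := by
  obtain ⟨lam, Lam, hlam, -, hγ, hell⟩ := ha
  refine ⟨contDiffOn_partialDeriv hU hu.1 1, contDiffOn_partialDeriv hU hu.1 0, fun x hx => ?_⟩
  have h := sq_add_sq_le_of_elliptic hlam hγ (hell x hx) (hu.2 x hx)
  rw [partialDeriv_comm (hu.1.contDiffAt (hU.mem_nhds hx)) 0 1]
  linarith

theorem IsQuasiconformalOn.mono {K : ℝ} {U V : Set Plane} {p q : Plane → ℝ}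
    (h : IsQuasiconformalOn K U p q) (hVU : V ⊆ U) : IsQuasiconformalOn K V p q :=
  ⟨h.1.mono hVU, h.2.1.mono hVU, fun x hx => h.2.2 x (hVU hx)⟩

/-! ### The exterior domain -/

/-- A ball of radius `dist (Ω, ∂Ω')` about a point outside `Ω'` does not meet `closure Ω`: a
segment from its centre to `Ω` crosses the boundary of `Ω'`. -/
theorem ball_subset_compl_closure {Ω Ω' : Set Plane} {d : ℝ} (hΩ : closure Ω ⊆ Ω')
    (hd : ∀ a ∈ Ω, ∀ b ∈ frontier Ω', d ≤ dist a b) {x : Plane} (hx : x ∉ Ω') :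
    Metric.ball x d ⊆ (closure Ω)ᶜ := by
  suffices h : Disjoint (Metric.ball x d) Ω from
    (h.closure_right Metric.isOpen_ball).subset_compl_right
  rw [Set.disjoint_left]
  intro y hy hyΩ
  obtain ⟨z, hz, hzf⟩ : (segment ℝ y x ∩ frontier Ω').Nonempty := by
    by_contra hne
    have hcover : segment ℝ y x ⊆ interior Ω' ∪ (closure Ω')ᶜ := fun z hz => by
      by_contra hz'
      rw [mem_union, not_or, notMem_compl_iff] at hz'
      exact hne ⟨z, hz, hz'.2, hz'.1⟩
    have hy' := left_mem_segment ℝ y x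
    have hx' := right_mem_segment ℝ y x
    obtain ⟨z, -, hz₁, hz₂⟩ := (convex_segment y x).isPreconnected _ _ isOpen_interior
      isClosed_closure.isOpen_compl hcover
      ⟨y, hy', (hcover hy').resolve_right fun h => h (subset_closure (hΩ (subset_closure hyΩ)))⟩
      ⟨x, hx', (hcover hx').resolve_left fun h => hx (interior_subset h)⟩
    exact hz₂ (subset_closure (interior_subset hz₁))
  have h1 := dist_add_dist_of_mem_segment hz
  have h2 := hd y hyΩ z hzf
  rw [Metric.mem_ball] at hy
  linarith [dist_nonneg (x := z) (y := x)]

/-- A function on the plane whose oscillation outside the discs `|z| ≤ ρ` is `O(ρ ^ (-α))` has a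
limit at infinity. -/
theorem exists_tendsto_cobounded {F : Plane → Plane} {r B α : ℝ} (hr : 0 < r) (hα : 0 < α)
    (h : ∀ x y, r < ‖x‖ → ‖x‖ ≤ ‖y‖ → ‖F x - F y‖ ≤ B * (‖x‖ / r) ^ (-α)) :
    ∃ L, Tendsto F (Bornology.cobounded Plane) (𝓝 L) ∧
      ∀ x, r < ‖x‖ → ‖F x - L‖ ≤ B * (‖x‖ / r) ^ (-α) := by
  have hex : ∃ L, Tendsto F (Bornology.cobounded Plane) (𝓝 L) := by
    refine cauchy_map_iff_exists_tendsto.1 (Metric.cauchy_iff.2 ⟨inferInstance, fun δ hδ => ?_⟩)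
    have hlim : Tendsto (fun t : ℝ => B * (t / r) ^ (-α)) atTop (𝓝 (B * 0)) :=
      ((tendsto_rpow_neg_atTop hα).comp (tendsto_id.atTop_div_const hr)).const_mul B
    rw [mul_zero] at hlim
    obtain ⟨t, ht, htr⟩ :=
      ((hlim.eventually_lt_const (half_pos hδ)).and (eventually_gt_atTop r)).exists
    obtain ⟨z, hz⟩ := exists_norm_eq Plane (hr.trans htr).le
    refine ⟨F '' {y | t ≤ ‖y‖}, image_mem_map ?_, ?_⟩
    · filter_upwards [tendsto_norm_cobounded_atTop.eventually_ge_atTop t] with y hy using hy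
    · rintro _ ⟨y₁, hy₁, rfl⟩ _ ⟨y₂, hy₂, rfl⟩
      have h1 := h z y₁ (hz ▸ htr) (hz ▸ hy₁)
      have h2 := h z y₂ (hz ▸ htr) (hz ▸ hy₂)
      rw [hz] at h1 h2
      rw [← dist_eq_norm] at h1 h2
      linarith [dist_triangle_left (F y₁) (F y₂) (F z)]
  obtain ⟨L, hL⟩ := hex
  refine ⟨L, hL, fun x hx => le_of_tendsto (hL.const_sub (F x)).norm ?_⟩
  filter_upwards [tendsto_norm_cobounded_atTop.eventually_ge_atTop ‖x‖] with y hy using h x y hx hy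

theorem mainTheorem4 (γ : ℝ) (hγ : 1 ≤ γ) :
    ∃ α : ℝ, 0 < α ∧ α ≤ 1 ∧
      ∀ d : ℝ, 0 < d → ∀ M : ℝ,
        ∃ C : ℝ, ∀ R : ℝ, ∃ C' : ℝ,
          ∀ (Ω Ω' : Set Plane) (a₁₁ a₁₂ a₂₂ u : Plane → ℝ),
            IsOpen Ω → IsConnected Ω → Ω ⊆ Metric.ball 0 R →
            IsOpen Ω' → closure Ω ⊆ Ω' →
            -- `d` is the distance between `Ω` and the boundary of `Ω'`
            IsGLB (Set.image2 dist Ω (frontier Ω')) d →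
            IsUniformlyElliptic γ (closure Ω)ᶜ a₁₁ a₁₂ a₂₂ →
            IsClassicalSolution (closure Ω)ᶜ a₁₁ a₁₂ a₂₂ u →
            (∀ x ∈ (closure Ω)ᶜ, ‖gradient u x‖ ≤ M) →
            (∀ x ∈ (closure Ω')ᶜ, ∀ y ∈ (closure Ω')ᶜ,
                ‖gradient u x - gradient u y‖ ≤ C * ‖x - y‖ ^ α) ∧
            (∃ L : Plane,
                Tendsto (gradient u) (Bornology.cobounded Plane) (𝓝 L) ∧
                ∀ x ∈ (closure Ω')ᶜ, x ≠ 0 →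
                  ‖gradient u x - L‖ ≤ C' * ‖x‖ ^ (-α)) ∧
            IsQuasiconformalOn ((1 + γ) / 2) (closure Ω)ᶜ
              (partialDeriv 1 u) (partialDeriv 0 u) := by
  have hpi := Real.pi_gt_three
  set K := (1 + γ) / 2 with hKdef
  have hK1 : 1 ≤ K := by rw [hKdef]; linarith
  have hK : 0 < K := by linarith
  have hα : 0 < holderExponent K := by unfold holderExponent; positivity
  refine ⟨holderExponent K, hα, ?_, fun d hd M => ?_⟩
  · rw [holderExponent, div_le_one (by positivity)]
    nlinarith
  -- `N` is a positive bound for the gradient, and `B` covers both the oscillation estimate and the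
  -- trivial bound `2 * N`.
  set N := |M| + 1 with hN
  have hN0 : 0 < N := by positivity
  have hMN : M ≤ N := (le_abs_self M).trans (le_add_of_nonneg_right zero_le_one)
  set B := 2 * (oscillationConstant K N + N) with hB
  have hosc := oscillationConstant_nonneg hK hN0
  have hB0 : 0 ≤ B := by positivity
  have hoscB : 2 * oscillationConstant K N ≤ B := by rw [hB]; linarith
  have hNB : 2 * N ≤ B := by rw [hB]; linarith
  refine ⟨B / d ^ holderExponent K, fun R => ⟨B / R ^ (-holderExponent K), ?_⟩⟩
  intro Ω Ω' a₁₁ a₁₂ a₂₂ u _ hΩc hΩR _ hΩΩ' hdist hell hsol hbd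
  have hqc := isQuasiconformalOn_of_isClassicalSolution isClosed_closure.isOpen_compl hell hsol
  have hgrad : ∀ x ∈ (closure Ω)ᶜ, ‖gradient u x‖ ≤ N := fun x hx => (hbd x hx).trans hMN
  have hpart : ∀ i, ∀ x ∈ (closure Ω)ᶜ, |partialDeriv i u x| ≤ N := fun i x hx =>
    (abs_partialDeriv_le_norm_gradient u x i).trans (hgrad x hx)
  have hsub : (closure Ω')ᶜ ⊆ (closure Ω)ᶜ :=
    compl_subset_compl.2 (hΩΩ'.trans subset_closure)
  obtain ⟨ω, hω⟩ := hΩc.nonempty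
  have hR : 0 < R := Metric.pos_of_mem_ball (hΩR hω)
  refine ⟨fun x hx y hy => ?_, ?_, hqc⟩
  · rw [div_mul_eq_mul_div, mul_div_assoc, ← Real.div_rpow (norm_nonneg _) hd.le]
    rcases lt_or_ge ‖x - y‖ d with hlt | hge
    · have hball := ball_subset_compl_closure hΩΩ'
        (fun a ha b hb => hdist.1 (mem_image2_of_mem ha hb)) (fun h => hy (subset_closure h))
      obtain ⟨h1, h2⟩ := (hqc.mono hball).abs_sub_le_of_ball hK hN0
        (fun z hz => hpart 1 z (hball hz)) (fun z hz => hpart 0 z (hball hz))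
        (mem_ball_iff_norm.2 hlt)
      refine (norm_gradient_sub_le h1 h2).trans ?_
      rw [← mul_assoc]
      exact mul_le_mul_of_nonneg_right hoscB (by positivity)
    · have h1 : 1 ≤ (‖x - y‖ / d) ^ holderExponent K :=
        Real.one_le_rpow ((one_le_div hd).2 hge) hα.le
      refine (norm_sub_le _ _).trans (le_trans ?_ (le_mul_of_one_le_right hB0 h1))
      linarith [hgrad x (hsub hx), hgrad y (hsub hy)]
  · have hext : (Metric.closedBall (0 : Plane) R)ᶜ ⊆ (closure Ω)ᶜ := compl_subset_compl.2
      (closure_minimal (hΩR.trans Metric.ball_subset_closedBall) Metric.isClosed_closedBall)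
    obtain ⟨L, hL, hLx⟩ := exists_tendsto_cobounded (F := gradient u) (B := B) hR hα (by
      intro x y hx hxy
      obtain ⟨h1, h2⟩ := (hqc.mono hext).abs_sub_le_of_exterior hR hK hN0
        (fun z hz => hpart 1 z (hext hz)) (fun z hz => hpart 0 z (hext hz)) hx hxy
      refine (norm_gradient_sub_le h1 h2).trans ?_
      rw [← mul_assoc]
      exact mul_le_mul_of_nonneg_right hoscB (by positivity))
    have hLN : ‖L‖ ≤ N := by
      refine le_of_tendsto hL.norm ?_
      filter_upwards [tendsto_norm_cobounded_atTop.eventually_gt_atTop R] with y hy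
      exact hgrad y (hext (by simpa using hy))
    refine ⟨L, hL, fun x hx hx0 => ?_⟩
    rw [div_mul_eq_mul_div, mul_div_assoc, ← Real.div_rpow (norm_nonneg _) hR.le]
    rcases lt_or_ge R ‖x‖ with hlt | hle
    · exact hLx x hlt
    · have h1 : 1 ≤ (‖x‖ / R) ^ (-holderExponent K) :=
        Real.one_le_rpow_of_pos_of_le_one_of_nonpos (div_pos (norm_pos_iff.2 hx0) hR)
          ((div_le_one hR).2 hle) (by linarith)
      refine (norm_sub_le _ _).trans (le_trans ?_ (le_mul_of_one_le_right hB0 h1))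
      linarith [hgrad x (hsub hx)]
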